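/- **Setting.** Fix a finite set $\mathcal M$ of modalities with raw feature dimensions $\delta_t$ ($t\in\mathcal M$), a common latent dimension $d$, a number $L$ of layers and a number $k$ of weight matrices per layer. A network parameter is a tuple $\theta=(W_{\mathrm{in}},(W^{(l)}_r)_{l\le L,\,r\le k},(W^{(l)}_0)_{l\le L},\psi)$ with $W_{\mathrm{in}}\in\mathbb R^{(\sum_t\delta_t)\times |\mathcal M|d}$, $W^{(l)}_r,W^{(l)}_0\in\mathbb R^{|\mathcal M|d\times|\mathcal M|d}$, and $\psi$ in a measurable space of remaining parameters (attention, biases, readout). $\Theta_{\mathrm{GNN}}$ is the set of all such tuples; $\Theta_{\mathrm{NSG}}$ is the set of those tuples in which every one of these matrices is block diagonal with one block per modality (for two modalities, $W=\begin{bmatrix}W_1&0\\0&W_2\end{bmatrix}$). A *general GNN* computes, from a graph $G$ on a vertex set $V$ and concatenated features $X=[X_t]_{t\in\mathcal M}$, the embeddings $E=XW_{\mathrm{in}}$, $H^{(0)}=E$, and in layer $l$ a new embedding of each node $v$ that is an arbitrary function (depending on $\psi,l,G,v$) of the rows of $H^{(l-1)}W^{(l)}_r$ in the closed neighbourhood of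 $v$ and of the row of $EW^{(l)}_0$ at $v$, followed by a nodewise readout. An *NSG network* (Node Splitting Graph network) has parameters in $\Theta_{\mathrm{NSG}}$; it does the same message passing on the node splitting graph, whose vertices are the pairs $\langle v,t\rangle$ (node, modality), where the sub-nodes of one node are joined by intra-node edges (the complete graph, or a sparser graph) and, for each edge $uv$ of $G$, sub-nodes of $u$ and $v$ are joined by self-type edges $\langle u,t\rangle\langle v,t\rangle$, by cross-type edges, or by both; finally the sub-node embeddings of each node are concatenated and read out. (Cross-type edges join $\langle u,i\rangle$ and $\langle v,j\rangle$ when $ij$ is an intra-node edge of $u$ or of $v$, i.e. for all $i\ne j$ when the intra-node graphs are complete.) Let $D$ be a probability distribution on $\mathcal X\times\mathcal Y$, let $S=(s_1,\dots,s_n)$, $n\ge1$, be i.i.d. from $D$, and let $L(f,x,y)$ be a real loss such that, for the given GNN and NSG architectures, $L(f_\theta,x,y)$ is jointly measurable in $(\theta,x,y)$. Put $R(f)=\mathbb E_{(x,y)\sim D}L(f,x,y)$ and $\hat R_S(f)=\frac1n\sum_iL(f,x_i,y_i)$ where $s_i=(x_i,y_i)$. Let $\sigma>0$ be such that for every GNN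 parameter $\theta\in\Theta_{\mathrm{GNN}}$ and every NSG parameter $\theta\in\Theta_{\mathrm{NSG}}$ the loss $L(f_\theta,x,y)$ of the respective network is $\sigma$-sub-Gaussian under $D$, i.e. $\mathbb E_D\,e^{\lambda(L(f_\theta,x,y)-R(f_\theta))}\le e^{\lambda^2\sigma^2/2}$ for all $\lambda\in\mathbb R$. Learned parameters are random variables on the same probability space as $S$, and $I(\cdot\,;\cdot)\in[0,\infty]$ is mutual information. **Claim.** 1. $\Theta_{\mathrm{NSG}}\subseteq\Theta_{\mathrm{GNN}}$, and there is a measurable map $T:\Theta_{\mathrm{GNN}}\to\Theta_{\mathrm{NSG}}$ with $T(w)=w$ for all $w\in\Theta_{\mathrm{NSG}}$. In particular every random NSG parameter $W_{\mathrm{NSG}}$ is of the form $T(W_{\mathrm{GNN}})$ for some random GNN parameter $W_{\mathrm{GNN}}$. 2. Let $W_{\mathrm{GNN}}$ be any random element of $\Theta_{\mathrm{GNN}}$, $T:\Theta_{\mathrm{GNN}}\to\Theta_{\mathrm{NSG}}$ any measurable map, and $W_{\mathrm{NSG}}=T(W_{\mathrm{GNN}})$. Then $S\to W_{\mathrm{GNN}}\to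 W_{\mathrm{NSG}}$ is a Markov chain ($S$ and $W_{\mathrm{NSG}}$ are conditionally independent given $W_{\mathrm{GNN}}$), and $$I(S;W_{\mathrm{NSG}})\le I(S;W_{\mathrm{GNN}}).$$ For each of the two models (write $W$ for its parameter and $f_W$ for its network), $\hat R_S(f_W)-R(f_W)$ is integrable if $I(S;W)<\infty$, and the expected generalization gap satisfies $$\bigl|\mathbb E[\hat R_S(f_W)-R(f_W)]\bigr|\le\sqrt{\tfrac{2\sigma^2}{n}I(S;W)}$$ (the right-hand side being $+\infty$ if $I(S;W)=\infty$). The bound for NSG is no larger than the bound for the GNN: $$\sqrt{\tfrac{2\sigma^2}{n}I(S;W_{\mathrm{NSG}})}\le\sqrt{\tfrac{2\sigma^2}{n}I(S;W_{\mathrm{GNN}})}.$$ -/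

import Mathlib

open MeasureTheory ProbabilityTheory InformationTheory
open scoped ENNReal NNReal

noncomputable section

/-! ### Block weights and parameter spaces -/

/-- Real matrices carry the product (equivalently, Borel) σ-algebra on their entries. -/
instance Matrix.instMeasurableSpaceReal {m n : Type*} : MeasurableSpace (Matrix m n ℝ) :=
  inferInstanceAs (MeasurableSpace (m → n → ℝ))

/-- Column index of the concatenated raw features `[X_1 … X_m]`; modality `t` has dimension
`δ t`. -/
abbrev RawIdx (M : Type*) (δ : M → ℕ) := (t : M) × Fin (δ t)

/-- Column index of the concatenated latent embeddings `[E_1 … E_m]`, each of dimension `d`. -/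
abbrev HidIdx (M : Type*) (d : ℕ) := (_ : M) × Fin d

/-- Parameters of an `L`-layer graph network acting on concatenated multimodal embeddings:
the input projection, `k` weight matrices per layer applied to the previous embeddings
(for instance one per relation), one residual weight matrix per layer applied to the initial
embeddings, and all remaining parameters `Ψ` (attention, biases, readout, ...). -/
abbrev NetParam (M : Type*) (δ : M → ℕ) (d L k : ℕ) (Ψ : Type*) :=
  Matrix (RawIdx M δ) (HidIdx M d) ℝ ×
    (Fin L → Fin k → Matrix (HidIdx M d) (HidIdx M d) ℝ) ×
    (Fin L → Matrix (HidIdx M d) (HidIdx M d) ℝ) × Ψ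

/-- `Θ_GNN`: the weight matrices of a general GNN are unrestricted. -/
def gnnParamSpace (M : Type*) (δ : M → ℕ) (d L k : ℕ) (Ψ : Type*) :
    Set (NetParam M δ d L k Ψ) := Set.univ

/-- `Θ_NSG`: every weight matrix is block diagonal, with one block per modality. -/
def nsgParamSpace (M : Type*) [DecidableEq M] (δ : M → ℕ) (d L k : ℕ) (Ψ : Type*) :
    Set (NetParam M δ d L k Ψ) :=
  {θ | (∃ B : (t : M) → Matrix (Fin (δ t)) (Fin d) ℝ, θ.1 = Matrix.blockDiagonal' B) ∧
    (∀ l r, ∃ B : M → Matrix (Fin d) (Fin d) ℝ, θ.2.1 l r = Matrix.blockDiagonal' B) ∧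
    (∀ l, ∃ B : M → Matrix (Fin d) (Fin d) ℝ, θ.2.2.1 l = Matrix.blockDiagonal' B)}

/-! ### General message-passing networks -/

/-- A predictor maps a graph and its concatenated raw features to node outputs. -/
abbrev Predictor (V M : Type*) (δ : M → ℕ) (o : ℕ) :=
  SimpleGraph V → Matrix V (RawIdx M δ) ℝ → V → Fin o → ℝ

/-- The choices defining a message-passing network on the original graph. In each layer the new
embedding of `v` is an arbitrary function of the linearly transformed embeddings of the closed
neighbourhood of `v` and of the linearly transformed initial embedding of `v`
(so any propagation matrix, attention, aggregation and activation is allowed). -/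
structure GNNArch (V M : Type*) (d L k o : ℕ) (Ψ : Type*) where
  update : Ψ → Fin L → (G : SimpleGraph V) → (v : V) →
    (Fin k → {u : V // u = v ∨ G.Adj v u} → HidIdx M d → ℝ) →
    (HidIdx M d → ℝ) → HidIdx M d → ℝ
  readout : Ψ → (HidIdx M d → ℝ) → Fin o → ℝ

/-- The function computed by the network with parameters `θ`: `E = X W_in`, `H⁰ = E`, layers
`Hˡ_v = update ((Hˡ⁻¹ Wˡ_r)_u, u ∈ N[v], r; (E W₀ˡ)_v)`, followed by a nodewise readout. -/
def GNNArch.predict {V M : Type*} [Fintype M] {δ : M → ℕ} {d L k o : ℕ} {Ψ : Type*}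
    (A : GNNArch V M d L k o Ψ) (θ : NetParam M δ d L k Ψ) : Predictor V M δ o :=
  fun G X v =>
    let E : Matrix V (HidIdx M d) ℝ := X * θ.1
    let H : Matrix V (HidIdx M d) ℝ := (List.finRange L).foldl
      (fun H l => Matrix.of fun v =>
        A.update θ.2.2.2 l G v (fun r u => (H * θ.2.1 l r) u.1) ((E * θ.2.2.1 l) v)) E
    A.readout θ.2.2.2 (H v)

/-! ### Node splitting graphs -/

/-- Which inter-node edges the node splitting graph contains. -/
inductive InterEdges
  | selfType
  | crossType
  | hybrid

/-- The node splitting graph of `G`: vertices `⟨v, i⟩` with `v` a node and `i` a modality. The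
sub-nodes of `v` are joined by intra-node edges according to `C v` (the complete graph on the
modalities, or a spanning tree in the sparsified version). For an edge `uv` of `G`, self-type
edges join `⟨u, i⟩` and `⟨v, i⟩`, and cross-type edges join `⟨u, i⟩` and `⟨v, j⟩` if `ij` is an
intra-node edge of `u` or of `v` (that is, if `i ≠ j`, when the `C v` are complete). -/
def nodeSplitGraph {V M : Type*} (κ : InterEdges) (C : V → SimpleGraph M)
    (G : SimpleGraph V) : SimpleGraph (V × M) where
  Adj p q := (p.1 = q.1 ∧ (C p.1).Adj p.2 q.2) ∨
    (G.Adj p.1 q.1 ∧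
      match κ with
      | .selfType => p.2 = q.2
      | .crossType => (C p.1).Adj p.2 q.2 ∨ (C q.1).Adj p.2 q.2
      | .hybrid => p.2 = q.2 ∨ (C p.1).Adj p.2 q.2 ∨ (C q.1).Adj p.2 q.2)
  symm := ⟨by
    rintro ⟨u, i⟩ ⟨v, j⟩ h
    rcases h with ⟨rfl, h⟩ | ⟨h, h'⟩
    · exact Or.inl ⟨rfl, h.symm⟩
    · refine Or.inr ⟨h.symm, ?_⟩
      cases κ <;> simp_all only [SimpleGraph.adj_comm] <;> tauto⟩
  loopless := ⟨by
    rintro ⟨u, i⟩ h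
    rcases h with ⟨_, h⟩ | ⟨h, _⟩
    · exact h.ne rfl
    · exact h.ne rfl⟩

/-- The choices defining an NSG network: the kind of inter-node edges, the intra-node edges
(which may depend on the graph and on the embeddings), heterogeneous message passing between
sub-nodes of the node splitting graph, and the readout applied to the merged embeddings. -/
structure NSGArch (V M : Type*) (d L k o : ℕ) (Ψ : Type*) where
  inter : InterEdges
  intra : SimpleGraph V → Matrix V (HidIdx M d) ℝ → V → SimpleGraph M
  update : Ψ → Fin L → (Gs : SimpleGraph (V × M)) → (p : V × M) →
    (Fin k → {q : V × M // q = p ∨ Gs.Adj p q} → Fin d → ℝ) →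
    (Fin d → ℝ) → Fin d → ℝ
  readout : Ψ → (HidIdx M d → ℝ) → Fin o → ℝ

/-- The function computed by the NSG network with parameters `θ`. Row `v` of `H` is the
concatenation of the embeddings of the sub-nodes `⟨v, t⟩`, and the part `⟨s, ·⟩` of row `u` of
`H W` is the transformed embedding of `⟨u, s⟩`; it equals `H_s W_s` when `W` is block diagonal
with blocks `W_s`. -/
def NSGArch.predict {V M : Type*} [Fintype M] {δ : M → ℕ} {d L k o : ℕ} {Ψ : Type*}
    (A : NSGArch V M d L k o Ψ) (θ : NetParam M δ d L k Ψ) : Predictor V M δ o :=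
  fun G X v =>
    let E : Matrix V (HidIdx M d) ℝ := X * θ.1
    let Gs : SimpleGraph (V × M) := nodeSplitGraph A.inter (A.intra G E) G
    let H : Matrix V (HidIdx M d) ℝ := (List.finRange L).foldl
      (fun H l => Matrix.of fun v c =>
        A.update θ.2.2.2 l Gs (v, c.1)
          (fun r q j => (H * θ.2.1 l r) q.1.1 ⟨q.1.2, j⟩)
          (fun j => (E * θ.2.2.1 l) v ⟨c.1, j⟩) c.2) E
    A.readout θ.2.2.2 (H v)

/-! ### Risk and information -/

/-- `R(f) = E_{(x, y) ∼ D} L(f, x, y)`. -/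
def risk {F 𝒳 𝒴 : Type*} [MeasurableSpace 𝒳] [MeasurableSpace 𝒴]
    (loss : F → 𝒳 → 𝒴 → ℝ) (D : Measure (𝒳 × 𝒴)) (f : F) : ℝ :=
  ∫ z, loss f z.1 z.2 ∂D

/-- The empirical loss over the sample `s = (s_1, …, s_n)`. -/
def empRisk {F 𝒳 𝒴 : Type*} {n : ℕ} (loss : F → 𝒳 → 𝒴 → ℝ) (s : Fin n → 𝒳 × 𝒴) (f : F) : ℝ :=
  (∑ i, loss f (s i).1 (s i).2) / n

/-- Mutual information `I(X; Y)`, with values in `[0, ∞]`. -/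
def mutualInfo {Ω α β : Type*} [MeasurableSpace Ω] [MeasurableSpace α] [MeasurableSpace β]
    (μ : Measure Ω) (X : Ω → α) (Y : Ω → β) : ℝ≥0∞ :=
  klDiv (μ.map fun ω => (X ω, Y ω)) ((μ.map X).prod (μ.map Y))

/-- `X → Y → Z` is a Markov chain: `X` and `Z` are conditionally independent given `Y`. -/
def IsMarkovChain {Ω α β γ : Type*} [MeasurableSpace Ω] [MeasurableSpace α]
    [mβ : MeasurableSpace β] [MeasurableSpace γ]
    (μ : Measure Ω) (X : Ω → α) (Y : Ω → β) (Z : Ω → γ) : Prop :=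
  ∀ (A : Set α) (B : Set γ), MeasurableSet A → MeasurableSet B →
    μ⟦X ⁻¹' A ∩ Z ⁻¹' B | mβ.comap Y⟧ =ᵐ[μ]
      μ⟦X ⁻¹' A | mβ.comap Y⟧ * μ⟦Z ⁻¹' B | mβ.comap Y⟧

/-- The bound `√(2σ² I / n)`, with values in `[0, ∞]`. -/
def infoBound (σ : ℝ≥0) (n : ℕ) (I : ℝ≥0∞) : ℝ≥0∞ :=
  (((2 * σ ^ 2 / n : ℝ≥0) : ℝ≥0∞) * I) ^ (1 / 2 : ℝ)

end

/-!
Keeping only the diagonal blocks of every weight matrix retracts `Θ_GNN` onto `Θ_NSG`, and the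
mutual information comparison is the data processing inequality for `W_GNN ↦ T W_GNN`.

The generalization bound is a change of measure. Under the product of the laws of `S` and `W`, the
gap `R̂_S(f_W) - R(f_W)` is sub-Gaussian with variance proxy `σ² / n`, because for fixed `θ` it is
an average of `n` independent sub-Gaussian variables. The Donsker–Varadhan inequality
`∫ t g dP ≤ KL(P ‖ Q) + log ∫ exp (t g) dQ` transfers this to the joint law `P` of `(S, W)`, where
`KL(P ‖ Q) = I(S; W)`, and optimizing over `t` produces the square root.
-/

section BlockDiagonal

variable {M : Type*} [DecidableEq M]

/-- The block diagonal part of a matrix with blocks indexed by `M`: entries outside the diagonal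
blocks are replaced by zero. -/
def blockDiagPart {p q : M → Type*} {α : Type*} [Zero α]
    (W : Matrix ((t : M) × p t) ((t : M) × q t) α) : Matrix ((t : M) × p t) ((t : M) × q t) α :=
  Matrix.blockDiagonal' W.blockDiag'

lemma blockDiagPart_eq_self {p q : M → Type*} {α : Type*} [Zero α]
    {W : Matrix ((t : M) × p t) ((t : M) × q t) α}
    (hW : ∃ B : (t : M) → Matrix (p t) (q t) α, W = Matrix.blockDiagonal' B) :
    blockDiagPart W = W := by
  obtain ⟨B, rfl⟩ := hW
  rw [blockDiagPart, Matrix.blockDiag'_blockDiagonal']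

lemma measurable_blockDiagPart {p q : M → Type*} :
    Measurable (blockDiagPart : Matrix ((t : M) × p t) ((t : M) × q t) ℝ → _) := by
  refine measurable_pi_lambda _ fun ⟨s, i⟩ => measurable_pi_lambda _ fun ⟨t, j⟩ => ?_
  rcases eq_or_ne s t with rfl | hst
  · simp only [blockDiagPart, Matrix.blockDiagonal'_apply_eq, Matrix.blockDiag'_apply]
    exact (measurable_pi_apply _).comp (measurable_pi_apply _)
  · simp only [blockDiagPart, Matrix.blockDiagonal'_apply_ne _ _ _ hst]
    exact measurable_const

variable {δ : M → ℕ} {d L k : ℕ} {Ψ : Type*}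

/-- The retraction of `Θ_GNN` onto `Θ_NSG` that keeps the block diagonal part of every weight
matrix and leaves the remaining parameters in `Ψ` unchanged. -/
def nsgRetraction (θ : gnnParamSpace M δ d L k Ψ) : nsgParamSpace M δ d L k Ψ :=
  ⟨(blockDiagPart θ.1.1, fun l r => blockDiagPart (θ.1.2.1 l r),
      fun l => blockDiagPart (θ.1.2.2.1 l), θ.1.2.2.2),
    ⟨_, rfl⟩, fun _ _ => ⟨_, rfl⟩, fun _ => ⟨_, rfl⟩⟩

lemma nsgRetraction_inclusion (h : nsgParamSpace M δ d L k Ψ ⊆ gnnParamSpace M δ d L k Ψ)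
    (w : nsgParamSpace M δ d L k Ψ) : nsgRetraction (Set.inclusion h w) = w := by
  obtain ⟨θ, hW_in, hW, hW₀⟩ := w
  exact Subtype.ext <| Prod.ext (blockDiagPart_eq_self hW_in) <|
    Prod.ext (funext₂ fun l r => blockDiagPart_eq_self (hW l r)) <|
      Prod.ext (funext fun l => blockDiagPart_eq_self (hW₀ l)) rfl

lemma measurable_nsgRetraction [MeasurableSpace Ψ] :
    Measurable (nsgRetraction : gnnParamSpace M δ d L k Ψ → nsgParamSpace M δ d L k Ψ) := by
  have hW (l : Fin L) (r : Fin k) :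
      Measurable fun θ : gnnParamSpace M δ d L k Ψ => θ.1.2.1 l r := by fun_prop
  have hW₀ (l : Fin L) : Measurable fun θ : gnnParamSpace M δ d L k Ψ => θ.1.2.2.1 l := by fun_prop
  refine Measurable.subtype_mk ?_
  exact (measurable_blockDiagPart.comp measurable_subtype_coe.fst).prodMk <|
    (measurable_pi_lambda _ fun l => measurable_pi_lambda _ fun r =>
      measurable_blockDiagPart.comp (hW l r)).prodMk <|
    (measurable_pi_lambda _ fun l => measurable_blockDiagPart.comp (hW₀ l)).prodMk
      measurable_subtype_coe.snd.snd.snd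

end BlockDiagonal

section DataProcessing

lemma condExp_indicator_inter_ae_eq_mul {Ω : Type*} {m mΩ : MeasurableSpace Ω} {μ : Measure Ω}
    [IsFiniteMeasure μ] (hm : m ≤ mΩ) {s t : Set Ω} (hs : MeasurableSet s)
    (ht : MeasurableSet[m] t) : μ⟦s ∩ t | m⟧ =ᵐ[μ] μ⟦s | m⟧ * μ⟦t | m⟧ := by
  have hs_int : Integrable (s.indicator fun _ => (1 : ℝ)) μ := (integrable_const 1).indicator hs
  have ht_self : μ⟦t | m⟧ = t.indicator fun _ => (1 : ℝ) :=
    condExp_of_stronglyMeasurable hm (stronglyMeasurable_const.indicator ht)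
      ((integrable_const 1).indicator (hm t ht))
  rw [ht_self, Set.inter_comm, ← Set.indicator_indicator]
  filter_upwards [condExp_indicator hs_int ht] with ω hω
  rw [hω, Pi.mul_apply, ← Set.indicator_mul_right]
  simp only [mul_one]

variable {Ω α β α' β' : Type*} [MeasurableSpace Ω] [MeasurableSpace α] [MeasurableSpace β]
  [MeasurableSpace α'] [MeasurableSpace β'] {μ : Measure Ω} [IsFiniteMeasure μ]
  {X : Ω → α} {Y : Ω → β}

lemma isMarkovChain_comp {T : β → β'} (hX : Measurable X) (hY : Measurable Y)
    (hT : Measurable T) : IsMarkovChain μ X Y (T ∘ Y) := fun _ B hA hB =>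
  condExp_indicator_inter_ae_eq_mul hY.comap_le (hX hA) ⟨T ⁻¹' B, hT hB, rfl⟩

lemma mutualInfo_comp_le {f : α → α'} {g : β → β'} (hX : AEMeasurable X μ)
    (hY : AEMeasurable Y μ) (hf : Measurable f) (hg : Measurable g) :
    mutualInfo μ (f ∘ X) (g ∘ Y) ≤ mutualInfo μ X Y := by
  have h_joint : μ.map (fun ω => ((f ∘ X) ω, (g ∘ Y) ω))
      = (μ.map fun ω => (X ω, Y ω)).map (Prod.map f g) :=
    (AEMeasurable.map_map_of_aemeasurable (hf.prodMap hg).aemeasurable (hX.prodMk hY)).symm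
  have h_prod : (μ.map (f ∘ X)).prod (μ.map (g ∘ Y))
      = ((μ.map X).prod (μ.map Y)).map (Prod.map f g) := by
    rw [← Measure.map_prod_map _ _ hf hg, AEMeasurable.map_map_of_aemeasurable hf.aemeasurable hX,
      AEMeasurable.map_map_of_aemeasurable hg.aemeasurable hY]
  rw [mutualInfo, mutualInfo, h_joint, h_prod]
  exact klDiv_map_le _ _ (hf.prodMap hg)

end DataProcessing

section ChangeOfMeasure

/-- Fenchel–Young: the convex conjugate of `klFun` is `y ↦ exp y - 1`. -/
lemma mul_le_klFun_add_exp_sub_one {x : ℝ} (hx : 0 ≤ x) (y : ℝ) :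
    x * y ≤ klFun x + (Real.exp y - 1) := by
  rcases hx.eq_or_lt with rfl | hx
  · simp only [zero_mul, klFun_zero, add_sub_cancel, Real.exp_nonneg]
  · have h_tangent := Real.add_one_le_exp (y - Real.log x)
    rw [Real.exp_sub, Real.exp_log hx, le_div_iff₀ hx] at h_tangent
    rw [klFun_apply]
    linarith

variable {α : Type*} [MeasurableSpace α] {P Q : Measure α} {f : α → ℝ}

lemma integrable_of_klDiv_ne_top [IsFiniteMeasure P] [IsFiniteMeasure Q] (h : klDiv P Q ≠ ∞)
    (hexp : Integrable (fun x => Real.exp (f x)) Q)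
    (hexp_neg : Integrable (fun x => Real.exp (-f x)) Q) : Integrable f P := by
  obtain ⟨hPQ, hllr⟩ := klDiv_ne_top_iff.1 h
  have hf : AEStronglyMeasurable f Q :=
    (Real.aemeasurable_of_aemeasurable_exp hexp.aemeasurable).aestronglyMeasurable
  have hkl := (integrable_klFun_rnDeriv_iff hPQ).2 hllr
  rw [← integrable_rnDeriv_smul_iff hPQ]
  refine ((hkl.add hexp).add hexp_neg).mono'
    ((Measure.measurable_rnDeriv P Q).ennreal_toReal.aestronglyMeasurable.smul hf)
    (ae_of_all _ fun x => ?_)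
  have h_upper := mul_le_klFun_add_exp_sub_one (x := (P.rnDeriv Q x).toReal)
    ENNReal.toReal_nonneg (f x)
  have h_lower := mul_le_klFun_add_exp_sub_one (x := (P.rnDeriv Q x).toReal)
    ENNReal.toReal_nonneg (-f x)
  have h_exp := Real.exp_pos (f x)
  have h_exp_neg := Real.exp_pos (-f x)
  rw [Real.norm_eq_abs, smul_eq_mul, abs_le, Pi.add_apply, Pi.add_apply]
  constructor <;> linarith

/-- The **Donsker–Varadhan inequality**. It amounts to `0 ≤ klDiv P (Q.tilted f)`. -/
lemma integral_le_toReal_klDiv_add_log_integral_exp [IsProbabilityMeasure P]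
    [IsProbabilityMeasure Q] (h : klDiv P Q ≠ ∞) (hf : Integrable f P)
    (hexp : Integrable (fun x => Real.exp (f x)) Q) :
    ∫ x, f x ∂P ≤ (klDiv P Q).toReal + Real.log (∫ x, Real.exp (f x) ∂Q) := by
  obtain ⟨hPQ, hllr⟩ := klDiv_ne_top_iff.1 h
  have := isProbabilityMeasure_tilted hexp
  have h_tilted : (klDiv P (Q.tilted f)).toReal
      = (klDiv P Q).toReal - ∫ x, f x ∂P + Real.log (∫ x, Real.exp (f x) ∂Q) := by
    rw [toReal_klDiv_of_measure_eq (hPQ.trans (absolutelyContinuous_tilted hexp)) (by simp),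
      integral_llr_tilted_right hPQ hf hexp hllr, toReal_klDiv_of_measure_eq hPQ (by simp)]
  have h_nonneg : 0 ≤ (klDiv P (Q.tilted f)).toReal := ENNReal.toReal_nonneg
  linarith

end ChangeOfMeasure

section Subgaussian

variable {α : Type*} [MeasurableSpace α] {P Q : Measure α} {f : α → ℝ} {c : ℝ≥0}

lemma integrable_of_hasSubgaussianMGF_of_klDiv_ne_top [IsFiniteMeasure P] [IsFiniteMeasure Q]
    (hf : HasSubgaussianMGF f c Q) (h : klDiv P Q ≠ ∞) : Integrable f P :=
  integrable_of_klDiv_ne_top h (by simpa only [one_mul] using hf.integrable_exp_mul 1)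
    (by simpa only [neg_one_mul] using hf.integrable_exp_mul (-1))

lemma sq_integral_le_toReal_klDiv [IsProbabilityMeasure P] [IsProbabilityMeasure Q]
    (hf : HasSubgaussianMGF f c Q) (h : klDiv P Q ≠ ∞) :
    (∫ x, f x ∂P) ^ 2 ≤ 2 * c * (klDiv P Q).toReal := by
  have h_quadratic (t : ℝ) :
      0 ≤ (c / 2 : ℝ) * (t * t) + -(∫ x, f x ∂P) * t + (klDiv P Q).toReal := by
    have h_dv := integral_le_toReal_klDiv_add_log_integral_exp h
      ((integrable_of_hasSubgaussianMGF_of_klDiv_ne_top hf h).const_mul t)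
      (hf.integrable_exp_mul t)
    have h_cgf : Real.log (∫ x, Real.exp (t * f x) ∂Q) ≤ c * t ^ 2 / 2 := hf.cgf_le t
    rw [integral_const_mul] at h_dv
    linarith
  have h_discrim := discrim_le_zero h_quadratic
  rw [discrim] at h_discrim
  linarith

lemma hasSubgaussianMGF_prod {β : Type*} [MeasurableSpace β] {ν : Measure β}
    [IsProbabilityMeasure ν] [SFinite Q] {g : α × β → ℝ} (hg : AEMeasurable g (Q.prod ν))
    (h : ∀ᵐ b ∂ν, HasSubgaussianMGF (fun a => g (a, b)) c Q) :
    HasSubgaussianMGF g c (Q.prod ν) := by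
  have h_meas (t : ℝ) : AEStronglyMeasurable (fun p => Real.exp (t * g p)) (Q.prod ν) :=
    (hg.const_mul t).exp.aestronglyMeasurable
  have h_le (t : ℝ) : ∀ᵐ b ∂ν, ∫ a, Real.exp (t * g (a, b)) ∂Q ≤ Real.exp (c * t ^ 2 / 2) := by
    filter_upwards [h] with b hb using hb.mgf_le t
  have h_int_section (t : ℝ) : Integrable (fun b => ∫ a, Real.exp (t * g (a, b)) ∂Q) ν := by
    refine (integrable_const (Real.exp (c * t ^ 2 / 2))).mono'
      (h_meas t).prod_swap.integral_prod_right' ?_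
    filter_upwards [h_le t] with b hb
    rwa [Real.norm_of_nonneg (integral_nonneg fun _ => Real.exp_nonneg _)]
  have h_int (t : ℝ) : Integrable (fun p => Real.exp (t * g p)) (Q.prod ν) := by
    refine (integrable_prod_iff' (h_meas t)).2 ⟨?_, ?_⟩
    · filter_upwards [h] with b hb using hb.integrable_exp_mul t
    · simpa only [Real.norm_of_nonneg (Real.exp_nonneg _)] using h_int_section t
  refine ⟨h_int, fun t => ?_⟩
  calc mgf g (Q.prod ν) t = ∫ b, ∫ a, Real.exp (t * g (a, b)) ∂Q ∂ν :=
        integral_prod_symm _ (h_int t)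
    _ ≤ ∫ _, Real.exp (c * t ^ 2 / 2) ∂ν :=
        integral_mono_ae (h_int_section t) (integrable_const _) (h_le t)
    _ = Real.exp (c * t ^ 2 / 2) := by simp only [integral_const, probReal_univ, one_smul]

lemma hasSubgaussianMGF_average {ι : Type*} [Fintype ι] {X : ι → α → ℝ} (hX : iIndepFun X Q)
    (h : ∀ i, HasSubgaussianMGF (X i) c Q) :
    HasSubgaussianMGF (fun a => (∑ i, X i a) / Fintype.card ι) (c / Fintype.card ι) Q := by
  have h_sum := (HasSubgaussianMGF.sum_of_iIndepFun hX (s := Finset.univ)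
    fun i _ => h i).const_mul (Fintype.card ι : ℝ)⁻¹
  convert h_sum using 1
  · simp only [div_eq_inv_mul]
  · rw [Finset.sum_const, Finset.card_univ, nsmul_eq_mul]
    ext
    change (c / Fintype.card ι : ℝ) = (Fintype.card ι : ℝ)⁻¹ ^ 2 * (Fintype.card ι * c)
    field_simp

lemma hasSubgaussianMGF_average_pi {ι : Type*} [Fintype ι] [IsProbabilityMeasure Q]
    (hf : HasSubgaussianMGF f c Q) :
    HasSubgaussianMGF (fun s : ι → α => (∑ i, f (s i)) / Fintype.card ι) (c / Fintype.card ι)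
      (Measure.pi fun _ => Q) := by
  refine hasSubgaussianMGF_average (iIndepFun_pi fun _ => hf.aemeasurable) fun i => ?_
  have h_eval := measurePreserving_eval (fun _ : ι => Q) i
  exact .of_map (Y := Function.eval i) h_eval.aemeasurable (by rwa [h_eval.map_eq])

end Subgaussian

section InfoBound

lemma monotone_infoBound (σ : ℝ≥0) (n : ℕ) : Monotone (infoBound σ n) := fun _ _ h => by
  unfold infoBound
  gcongr

lemma infoBound_top {σ : ℝ≥0} (hσ : 0 < σ) {n : ℕ} (hn : 0 < n) : infoBound σ n ∞ = ∞ := by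
  have h_coeff : ((2 * σ ^ 2 / n : ℝ≥0) : ℝ≥0∞) ≠ 0 := by
    rw [ENNReal.coe_ne_zero]
    positivity
  rw [infoBound, ENNReal.mul_top h_coeff, ENNReal.top_rpow_of_pos (by norm_num)]

lemma ofReal_abs_le_infoBound {σ : ℝ≥0} {n : ℕ} {I : ℝ≥0∞} {x : ℝ}
    (hx : x ^ 2 ≤ 2 * ((σ ^ 2 / n : ℝ≥0) : ℝ) * I.toReal) :
    ENNReal.ofReal |x| ≤ infoBound σ n I := by
  rw [infoBound, one_div, ENNReal.le_rpow_inv_iff two_pos,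
    ENNReal.ofReal_rpow_of_nonneg (abs_nonneg x) two_pos.le, Real.rpow_two, sq_abs]
  refine ENNReal.ofReal_le_of_le_toReal (hx.trans_eq ?_)
  rw [ENNReal.toReal_mul, ENNReal.coe_toReal, mul_div_assoc, NNReal.coe_mul, NNReal.coe_ofNat]

end InfoBound

section GeneralizationGap

variable {F 𝒳 𝒴 Θ Ω : Type*} [MeasurableSpace 𝒳] [MeasurableSpace 𝒴] [MeasurableSpace Θ]
  [MeasurableSpace Ω] {μ : Measure Ω} {D : Measure (𝒳 × 𝒴)} {loss : F → 𝒳 → 𝒴 → ℝ} {f : Θ → F}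
  {n : ℕ} {S : Ω → Fin n → 𝒳 × 𝒴} {W : Ω → Θ} {c σ : ℝ≥0}

/-- The generalization gap `R̂_s(φ) - R(φ)` of a predictor `φ` on the sample `s`. -/
noncomputable def generalizationGap (loss : F → 𝒳 → 𝒴 → ℝ) (D : Measure (𝒳 × 𝒴))
    (s : Fin n → 𝒳 × 𝒴) (φ : F) : ℝ :=
  empRisk loss s φ - risk loss D φ

lemma generalizationGap_eq_average (hn : 0 < n) (s : Fin n → 𝒳 × 𝒴) (φ : F) :
    generalizationGap loss D s φ = (∑ i, (loss φ (s i).1 (s i).2 - risk loss D φ)) / n := by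
  have hn_ne : (n : ℝ) ≠ 0 := by positivity
  rw [generalizationGap, empRisk, Finset.sum_sub_distrib, sub_div, Finset.sum_const,
    Finset.card_univ, Fintype.card_fin, nsmul_eq_mul, mul_div_cancel_left₀ _ hn_ne]

lemma measurable_generalizationGap [SFinite D]
    (hm : Measurable fun p : Θ × (𝒳 × 𝒴) => loss (f p.1) p.2.1 p.2.2) :
    Measurable fun p : (Fin n → 𝒳 × 𝒴) × Θ => generalizationGap loss D p.1 (f p.2) := by
  have h_emp : Measurable fun p : (Fin n → 𝒳 × 𝒴) × Θ => empRisk loss p.1 (f p.2) :=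
    (Finset.measurable_sum _ fun i _ => hm.comp
      (measurable_snd.prodMk ((measurable_pi_apply i).comp measurable_fst))).div_const _
  have h_risk : Measurable fun θ => risk loss D (f θ) :=
    hm.stronglyMeasurable.integral_prod_right'.measurable
  exact h_emp.sub (h_risk.comp measurable_snd)

lemma hasSubgaussianMGF_generalizationGap [IsProbabilityMeasure D] (hn : 0 < n) {ν : Measure Θ}
    [IsProbabilityMeasure ν]
    (hm : Measurable fun p : Θ × (𝒳 × 𝒴) => loss (f p.1) p.2.1 p.2.2)
    (hsub : ∀ᵐ θ ∂ν, HasSubgaussianMGF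
      (fun z => loss (f θ) z.1 z.2 - risk loss D (f θ)) c D) :
    HasSubgaussianMGF (fun p : (Fin n → 𝒳 × 𝒴) × Θ => generalizationGap loss D p.1 (f p.2))
      (c / n) ((Measure.pi fun _ => D).prod ν) := by
  refine hasSubgaussianMGF_prod (measurable_generalizationGap hm).aemeasurable ?_
  filter_upwards [hsub] with θ hθ
  simpa only [generalizationGap_eq_average hn, Fintype.card_fin] using
    hasSubgaussianMGF_average_pi (ι := Fin n) hθ

variable [IsProbabilityMeasure μ] [IsProbabilityMeasure D]

lemma integrable_generalizationGap (hn : 0 < n) (hS : AEMeasurable S μ)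
    (hS_law : μ.map S = Measure.pi fun _ => D) (hW : AEMeasurable W μ)
    (hm : Measurable fun p : Θ × (𝒳 × 𝒴) => loss (f p.1) p.2.1 p.2.2)
    (hsub : ∀ᵐ θ ∂μ.map W, HasSubgaussianMGF
      (fun z => loss (f θ) z.1 z.2 - risk loss D (f θ)) c D)
    (hI : mutualInfo μ S W ≠ ∞) :
    Integrable (fun ω => generalizationGap loss D (S ω) (f (W ω))) μ := by
  have := Measure.isProbabilityMeasure_map hW
  rw [mutualInfo, hS_law] at hI
  exact (integrable_of_hasSubgaussianMGF_of_klDiv_ne_top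
    (hasSubgaussianMGF_generalizationGap hn hm hsub) hI).comp_aemeasurable (hS.prodMk hW)

lemma sq_integral_generalizationGap_le (hn : 0 < n) (hS : AEMeasurable S μ)
    (hS_law : μ.map S = Measure.pi fun _ => D) (hW : AEMeasurable W μ)
    (hm : Measurable fun p : Θ × (𝒳 × 𝒴) => loss (f p.1) p.2.1 p.2.2)
    (hsub : ∀ᵐ θ ∂μ.map W, HasSubgaussianMGF
      (fun z => loss (f θ) z.1 z.2 - risk loss D (f θ)) c D)
    (hI : mutualInfo μ S W ≠ ∞) :
    (∫ ω, generalizationGap loss D (S ω) (f (W ω)) ∂μ) ^ 2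
      ≤ 2 * ((c / n : ℝ≥0) : ℝ) * (mutualInfo μ S W).toReal := by
  have := Measure.isProbabilityMeasure_map hW
  have := Measure.isProbabilityMeasure_map (hS.prodMk hW)
  rw [mutualInfo, hS_law] at hI ⊢
  rw [← integral_map (hS.prodMk hW)
    (measurable_generalizationGap (D := D) hm).aestronglyMeasurable]
  exact sq_integral_le_toReal_klDiv (hasSubgaussianMGF_generalizationGap hn hm hsub) hI

lemma ofReal_abs_integral_generalizationGap_le (hn : 0 < n) (hσ : 0 < σ) (hS : AEMeasurable S μ)
    (hS_law : μ.map S = Measure.pi fun _ => D) (hW : AEMeasurable W μ)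
    (hm : Measurable fun p : Θ × (𝒳 × 𝒴) => loss (f p.1) p.2.1 p.2.2)
    (hsub : ∀ᵐ θ ∂μ.map W, HasSubgaussianMGF
      (fun z => loss (f θ) z.1 z.2 - risk loss D (f θ)) (σ ^ 2) D) :
    ENNReal.ofReal |∫ ω, generalizationGap loss D (S ω) (f (W ω)) ∂μ|
      ≤ infoBound σ n (mutualInfo μ S W) := by
  rcases eq_or_ne (mutualInfo μ S W) ∞ with hI | hI
  · rw [hI, infoBound_top hσ hn]
    exact le_top
  · exact ofReal_abs_le_infoBound
      (sq_integral_generalizationGap_le hn hS hS_law hW hm hsub hI)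

end GeneralizationGap

theorem mainTheorem2
    {V M : Type*} [Fintype M] [DecidableEq M] {δ : M → ℕ} {d L k o : ℕ}
    {Ψ : Type*} [MeasurableSpace Ψ]
    {𝒳 𝒴 : Type*} [MeasurableSpace 𝒳] [MeasurableSpace 𝒴]
    {Ω : Type*} [MeasurableSpace Ω] (μ : Measure Ω) [IsProbabilityMeasure μ]
    -- the two networks
    (gnn : GNNArch V M d L k o Ψ) (nsg : NSGArch V M d L k o Ψ)
    -- the data distribution and the i.i.d. training sample
    (D : Measure (𝒳 × 𝒴)) [IsProbabilityMeasure D]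
    {n : ℕ} (hn : 0 < n) (S : Ω → Fin n → 𝒳 × 𝒴) (hS : Measurable S)
    (hS_law : μ.map S = Measure.pi fun _ => D)
    -- the loss is measurable and sub-Gaussian for both networks
    (loss : Predictor V M δ o → 𝒳 → 𝒴 → ℝ) (σ : ℝ≥0) (hσ : 0 < σ)
    (hm_gnn : Measurable fun p : gnnParamSpace M δ d L k Ψ × (𝒳 × 𝒴) =>
      loss (gnn.predict p.1.1) p.2.1 p.2.2)
    (hm_nsg : Measurable fun p : nsgParamSpace M δ d L k Ψ × (𝒳 × 𝒴) =>
      loss (nsg.predict p.1.1) p.2.1 p.2.2)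
    (hsub_gnn : ∀ θ ∈ gnnParamSpace M δ d L k Ψ,
      HasSubgaussianMGF
        (fun z => loss (gnn.predict θ) z.1 z.2 - risk loss D (gnn.predict θ)) (σ ^ 2) D)
    (hsub_nsg : ∀ θ ∈ nsgParamSpace M δ d L k Ψ,
      HasSubgaussianMGF
        (fun z => loss (nsg.predict θ) z.1 z.2 - risk loss D (nsg.predict θ)) (σ ^ 2) D) :
    -- the NSG parameter space is a measurable image (a retract) of the GNN parameter space
    (∃ (hsubset : nsgParamSpace M δ d L k Ψ ⊆ gnnParamSpace M δ d L k Ψ)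
      (T : gnnParamSpace M δ d L k Ψ → nsgParamSpace M δ d L k Ψ),
      Measurable T ∧ (∀ w, T (Set.inclusion hsubset w) = w) ∧
      ∀ W_NSG : Ω → nsgParamSpace M δ d L k Ψ, Measurable W_NSG →
        ∃ W_GNN : Ω → gnnParamSpace M δ d L k Ψ, Measurable W_GNN ∧ W_NSG = T ∘ W_GNN) ∧
    -- comparison of the two models
    (∀ (W_GNN : Ω → gnnParamSpace M δ d L k Ψ)
      (T : gnnParamSpace M δ d L k Ψ → nsgParamSpace M δ d L k Ψ)
      (W_NSG : Ω → nsgParamSpace M δ d L k Ψ),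
      Measurable W_GNN → Measurable T → W_NSG = T ∘ W_GNN →
      IsMarkovChain μ S W_GNN W_NSG ∧
      mutualInfo μ S W_NSG ≤ mutualInfo μ S W_GNN ∧
      (mutualInfo μ S W_GNN ≠ ∞ →
        Integrable (fun ω => empRisk loss (S ω) (gnn.predict (W_GNN ω).1)
          - risk loss D (gnn.predict (W_GNN ω).1)) μ) ∧
      (mutualInfo μ S W_NSG ≠ ∞ →
        Integrable (fun ω => empRisk loss (S ω) (nsg.predict (W_NSG ω).1)
          - risk loss D (nsg.predict (W_NSG ω).1)) μ) ∧
      ENNReal.ofReal |∫ ω, (empRisk loss (S ω) (gnn.predict (W_GNN ω).1)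
          - risk loss D (gnn.predict (W_GNN ω).1)) ∂μ|
        ≤ infoBound σ n (mutualInfo μ S W_GNN) ∧
      ENNReal.ofReal |∫ ω, (empRisk loss (S ω) (nsg.predict (W_NSG ω).1)
          - risk loss D (nsg.predict (W_NSG ω).1)) ∂μ|
        ≤ infoBound σ n (mutualInfo μ S W_NSG) ∧
      infoBound σ n (mutualInfo μ S W_NSG) ≤ infoBound σ n (mutualInfo μ S W_GNN)) := by
  have hsubset : nsgParamSpace M δ d L k Ψ ⊆ gnnParamSpace M δ d L k Ψ := Set.subset_univ _
  refine ⟨⟨hsubset, nsgRetraction, measurable_nsgRetraction, nsgRetraction_inclusion hsubset,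
    fun W hW => ⟨Set.inclusion hsubset ∘ W, (measurable_inclusion hsubset).comp hW,
      funext fun ω => (nsgRetraction_inclusion hsubset (W ω)).symm⟩⟩, ?_⟩
  rintro W T _ hW hT rfl
  let gnnNet (θ : gnnParamSpace M δ d L k Ψ) : Predictor V M δ o := gnn.predict θ.1
  let nsgNet (θ : nsgParamSpace M δ d L k Ψ) : Predictor V M δ o := nsg.predict θ.1
  have hTW := (hT.comp hW).aemeasurable (μ := μ)
  have hsub_W := ae_of_all (μ.map W) fun θ => hsub_gnn θ.1 θ.2
  have hsub_TW := ae_of_all (μ.map (T ∘ W)) fun θ => hsub_nsg θ.1 θ.2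
  have h_dpi : mutualInfo μ S (T ∘ W) ≤ mutualInfo μ S W :=
    mutualInfo_comp_le hS.aemeasurable hW.aemeasurable measurable_id hT
  exact ⟨isMarkovChain_comp hS hW hT, h_dpi,
    integrable_generalizationGap (f := gnnNet) hn hS.aemeasurable hS_law hW.aemeasurable
      hm_gnn hsub_W,
    integrable_generalizationGap (f := nsgNet) hn hS.aemeasurable hS_law hTW hm_nsg hsub_TW,
    ofReal_abs_integral_generalizationGap_le (f := gnnNet) hn hσ hS.aemeasurable hS_law
      hW.aemeasurable hm_gnn hsub_W,
    ofReal_abs_integral_generalizationGap_le (f := nsgNet) hn hσ hS.aemeasurable hS_law hTW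
      hm_nsg hsub_TW,
    monotone_infoBound σ n h_dpi⟩
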